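/- Fix a relational vocabulary $\tau$ (equality is a logical symbol), variables $x_0,x_1,\dots$, and put $X_n=\{x_i : i<n\}$. For $m\le n$ let $\mathcal F_{m,n}$ be the set of injections $X_m\to X_n$, and let $i_m$ be the identity on $X_m$. **Formulas.** Sets $\Psi^n_\alpha$ of $\mathcal L_{\infty,\omega}(\tau)$-formulas (conjunctions and disjunctions being unordered) are defined by recursion on the ordinal $\alpha$. $\Psi^n_0$ is the set of conjunctions deciding every atomic $\tau$-formula over $X_n$, with $x_i=x_i$ and $x_i\ne x_j$ for $i\neq j$. $\Psi^n_{\alpha+1}$ is the set of formulas $$\phi=\phi'\wedge\bigwedge_{\psi\in E}\exists x_n\,\psi\wedge\forall x_n\Bigl(x_n\notin X_n\to\bigvee_{\psi\in E}\psi\Bigr),\qquad \phi'\in\Psi^n_\alpha,\ E\subseteq\Psi^{n+1}_\alpha;$$ write $E(\phi)=E$. For limit $\alpha$, $\Psi^n_\alpha$ is the set of conjunctions $\bigwedge_{\beta<\alpha}\psi_\beta$ with $\psi_\beta\in\Psi^n_\beta$, $\psi_\beta=\psi_{\beta+1}'$ for all $\beta<\alpha$, and $\psi_\beta=\bigwedge_{\gamma<\beta}\psi_\gamma$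 for limit $\beta<\alpha$. Put $\Psi_\alpha=\bigcup_n\Psi^n_\alpha$. For $\alpha\le\beta$, the vertical projection $V_{\alpha,\beta}:\Psi_\beta\to\Psi_\alpha$ is given by $V_{\alpha,\alpha}=\mathrm{id}$, $V_{\alpha,\beta+1}(\phi)=V_{\alpha,\beta}(\phi')$ for $\alpha\le\beta$, and $V_{\alpha,\beta}(\phi)=$ the conjunct of $\phi$ in $\Psi_\alpha$ for limit $\beta>\alpha$. For $\phi\in\Psi^n_\alpha$ and $j\in\mathcal F_{m,n}$ the horizontal projection $H^n_\alpha(\phi,j)\in\Psi^m_\alpha$ is given as follows: $H^n_0(\phi,j)$ is the conjunction of the conjuncts of $\phi$ with all variables in the range of $j$, these being replaced by their $j$-preimages; $H^n_{\alpha+1}(\phi,j)$ is the $\psi\in\Psi^m_{\alpha+1}$ with $\psi'=H^n_\alpha(\phi',j)$ and $E(\psi)=\{H^{n+1}_\alpha(\theta,j\cup\{(x_m,y)\}) : \theta\in E(\phi),\ y\in X_{n+1}\setminus\operatorname{range}(j)\}$; and $H^n_\alpha(\phi,j)=\bigwedge_{\beta<\alpha}H^n_\beta(V_{\beta,\alpha}(\phi),j)$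 for limit $\alpha$. **Scott processes.** A sequence $\langle\Phi_\alpha:\alpha<\ell\rangle$ of sets $\Phi_\alpha\subseteq\Psi_\alpha$ is a *Scott process* if, with $\Phi^n_\alpha=\Phi_\alpha\cap\Psi^n_\alpha$: 1. $E(\phi)\subseteq\Phi_\alpha$ for all $\alpha+1<\ell$ and $\phi\in\Phi_{\alpha+1}$; 2. $\Phi_\alpha=V_{\alpha,\beta}[\Phi_\beta]$ for all $\alpha<\beta<\ell$; 3. $H^n_\alpha(\phi,j)\in\Phi^n_\alpha$ for all $\alpha<\ell$, $n\in\omega$, $j\in\mathcal F_{n,n}$, $\phi\in\Phi^n_\alpha$; 4. $\Phi^m_\alpha=H^n_\alpha[\Phi^n_\alpha\times\{i_m\}]$ for all $\alpha<\ell$ and $m<n$ in $\omega$; 5. $E(\phi)=V_{\alpha,\alpha+1}[\{\psi\in\Phi^{n+1}_{\alpha+1} : H^{n+1}_{\alpha+1}(\psi,i_n)=\phi\}]$ for all $\alpha+1<\ell$, $n\in\omega$, $\phi\in\Phi^n_{\alpha+1}$; 6. $E(V_{\alpha+1,\beta}(\phi))\subseteq V_{\alpha,\beta}[\{\psi\in\Phi^{n+1}_\beta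 : H^{n+1}_\beta(\psi,i_n)=\phi\}]$ for all $\alpha<\beta<\ell$, $n\in\omega$, $\phi\in\Phi^n_\beta$; 7. for all $\alpha<\ell$, $n,m\in\omega$, $\phi\in\Phi^n_\alpha$, $\psi\in\Phi^m_\alpha$ there are $\theta\in\Phi^{n+m}_\alpha$ and $j\in\mathcal F_{m,n+m}$ with $\phi=H^{n+m}_\alpha(\theta,i_n)$ and $\psi=H^{n+m}_\alpha(\theta,j)$. **Amalgamation.** A set $\Phi\subseteq\Psi_\delta$ *amalgamates* if for all $m<n$ in $\omega$, $\phi\in\Phi\cap\Psi^{m+1}_\delta$ and $\psi\in\Phi\cap\Psi^n_\delta$ with $H^{m+1}_\delta(\phi,i_m)=H^n_\delta(\psi,i_m)$ there are $\theta\in\Phi\cap\Psi^{n+1}_\delta$ and $y\in X_{n+1}\setminus X_m$ with $H^{n+1}_\delta(\theta,i_m\cup\{(x_m,y)\})=\phi$ and $H^{n+1}_\delta(\theta,i_n)=\psi$. **Models.** For a $\tau$-structure $M$ and an $n$-tuple $\bar a$ of distinct elements of $M$, the Scott formula $\phi^M_{\bar a,\alpha}\in\Psi^n_\alpha$ is given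 as follows: $\phi^M_{\bar a,0}$ is the conjunction of all atomic and negated atomic $\tau$-formulas over $X_n$ satisfied by $\bar a$ in $M$; $\phi^M_{\bar a,\alpha+1}$ has first conjunct $\phi^M_{\bar a,\alpha}$ and $E(\phi^M_{\bar a,\alpha+1})=\{\phi^M_{\bar a^\frown\langle c\rangle,\alpha} : c\in M\text{ not in }\bar a\}$; and $\phi^M_{\bar a,\alpha}=\bigwedge_{\beta<\alpha}\phi^M_{\bar a,\beta}$ for limit $\alpha$. Let $\Phi_\alpha(M)$ be the set of all $\phi^M_{\bar a,\alpha}$, $\bar a$ a finite tuple of distinct elements of $M$. $M$ is a *model* of $\langle\Phi_\alpha:\alpha<\ell\rangle$ if $\Phi_\alpha=\Phi_\alpha(M)$ for all $\alpha<\ell$. **Theorem.** Let $\langle\Phi_\alpha:\alpha\le\delta\rangle$ be a Scott process such that $\Phi_\delta$ is nonempty, amalgamates, and satisfies $|\Phi_\delta|\le\aleph_1$. Then $\langle\Phi_\alpha:\alpha\le\delta\rangle$ has a model. -/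

import Mathlib

open Cardinal

universe u v w x

namespace ScottAnalysis

/-! ## Variables

The set `X_n = {x_0, …, x_{n-1}}` is `Fin n`, and the injections from `X_m` into `X_n` are the
embeddings `Fin m ↪ Fin n`.  Likewise an `n`-tuple of distinct elements of `M` is an embedding
`Fin n ↪ M`, and `Fin.Embedding.snoc` extends a tuple by one new last entry. -/

/-- The inclusion `i_m`, as a function from `X_m` to `X_n`, for `m ≤ n`. -/
def incl {m n : ℕ} (h : m ≤ n) : Fin m ↪ Fin n := Fin.castLEEmb h

/-- For `j : X_m → X_n` injective and `y ∈ X_{n+1} \ range j`, the injection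
`j ∪ {(x_m, y)} : X_{m+1} → X_{n+1}`. -/
def extend {m n : ℕ} (j : Fin m ↪ Fin n) (y : Fin (n + 1))
    (hy : y ∉ Set.range (j.trans (incl n.le_succ))) : Fin (m + 1) ↪ Fin (n + 1) :=
  Fin.Embedding.snoc (j.trans (incl n.le_succ)) hy

/-- The atomic formulas `R(x_{f(0)}, …, x_{f(k-1)})` with variables from `X_n`, other than the
equalities. -/
def AtomF (L : FirstOrder.Language.{u, v}) (n : ℕ) : Type v :=
  Σ k : ℕ, L.Relations k × (Fin k → Fin n)

/-! ## The formulas in `Ψ^n_α`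

`Ψ^n_0` consists of the conjunctions that decide every atomic formula over `X_n`, where distinct
variables are taken to be distinct; such a conjunction is given by the set of relational atomic
formulas that occur positively in it (the equalities being decided: `x_i = x_i` and `x_i ≠ x_j`).
A formula in `Ψ^n_{α+1}` is given by its first conjunct `φ' ∈ Ψ^n_α` and by a set
`E ⊆ Ψ^{n+1}_α`, namely as `φ' ∧ ⋀_{ψ ∈ E} ∃ x_n ψ ∧ ∀ x_n (x_n ∉ X_n → ⋁_{ψ ∈ E} ψ)`, and a
formula in `Ψ^n_α` for limit `α` is the conjunction of a coherent sequence of formulas from the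
`Ψ^n_β`, `β < α`.  Unfolding this recursion, a formula in `Ψ^n_α` is given by a formula in `Ψ^n_0`
and one set of formulas `E_β ⊆ Ψ^{n+1}_β` for each `β < α`.  The three clauses of the recursion are
proved below (`zeroEquiv`, `succEquiv`, `exists_unique_limit`), and `toFormula` writes each element
of `Ψ^n_α` out as the infinitary formula that it stands for, injectively. -/

/-- The set `Ψ^n_α`. -/
def Psi (L : FirstOrder.Language.{u, v}) (α : Ordinal.{w}) (n : ℕ) : Type (max v (w + 1)) :=
  Set (AtomF L n) × (∀ β : Set.Iio α, Set (Psi L β.1 (n + 1)))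
termination_by α
decreasing_by exact β.2

namespace Psi

variable {L : FirstOrder.Language.{u, v}}

/-- The unfolding of `Ψ^n_α`. -/
def equiv (L : FirstOrder.Language.{u, v}) (α : Ordinal.{w}) (n : ℕ) :
    Psi L α n ≃ Set (AtomF L n) × (∀ β : Set.Iio α, Set (Psi L β.1 (n + 1))) :=
  Equiv.cast (by rw [Psi])

/-- The relational atomic formulas that occur positively in (the level `0` part of) `φ`. -/
def atoms {α : Ordinal.{w}} {n : ℕ} (φ : Psi L α n) : Set (AtomF L n) := (equiv L α n φ).1

/-- The set `E_β = E(V_{β+1,α}(φ))`, for `β < α`. -/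
def ext {α : Ordinal.{w}} {n : ℕ} (φ : Psi L α n) (β : Ordinal.{w}) (h : β < α) :
    Set (Psi L β (n + 1)) := (equiv L α n φ).2 ⟨β, h⟩

/-- The formula with the given atoms and the given sets `E_β`. -/
def mk {α : Ordinal.{w}} {n : ℕ} (A : Set (AtomF L n))
    (E : ∀ β : Ordinal.{w}, β < α → Set (Psi L β (n + 1))) : Psi L α n :=
  (equiv L α n).symm (A, fun β => E β.1 β.2)

@[simp] theorem atoms_mk {α : Ordinal.{w}} {n : ℕ} (A : Set (AtomF L n))
    (E : ∀ β : Ordinal.{w}, β < α → Set (Psi L β (n + 1))) : (mk A E).atoms = A := by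
  simp [atoms, mk]

@[simp] theorem ext_mk {α : Ordinal.{w}} {n : ℕ} (A : Set (AtomF L n))
    (E : ∀ β : Ordinal.{w}, β < α → Set (Psi L β (n + 1))) (β : Ordinal.{w}) (h : β < α) :
    (mk A E).ext β h = E β h := by
  simp [ext, mk]

theorem eq_of {α : Ordinal.{w}} {n : ℕ} {φ ψ : Psi L α n} (h₁ : φ.atoms = ψ.atoms)
    (h₂ : ∀ β (h : β < α), φ.ext β h = ψ.ext β h) : φ = ψ := by
  apply (equiv L α n).injective
  refine Prod.ext h₁ (funext fun β => h₂ β.1 β.2)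

/-- The vertical projection `V_{α,β} : Ψ^n_β → Ψ^n_α`, for `α ≤ β`. -/
def V {α β : Ordinal.{w}} (h : α ≤ β) {n : ℕ} (φ : Psi L β n) : Psi L α n :=
  mk φ.atoms fun γ hγ => φ.ext γ (hγ.trans_le h)

/-- The set `E(φ) ⊆ Ψ^{n+1}_α`, for `φ ∈ Ψ^n_{α+1}`. -/
def E {α : Ordinal.{w}} {n : ℕ} (φ : Psi L (α + 1) n) : Set (Psi L α (n + 1)) :=
  φ.ext α (lt_add_one _)

/-- The horizontal projection `H^n_α(φ, j)`, for `φ ∈ Ψ^n_α` and `j : X_m → X_n` injective. At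
level `0` one keeps the conjuncts with variables in the range of `j` and replaces each variable by
its `j`-preimage; above, `E` of the projection is the set of the `H^{n+1}(ψ, j ∪ {(x_m, y)})` for
`ψ` in `E` and `y ∈ X_{n+1} \ range j`. -/
def H {α : Ordinal.{w}} {m n : ℕ} (φ : Psi L α n) (j : Fin m ↪ Fin n) : Psi L α m :=
  mk {A | (⟨A.1, A.2.1, j ∘ A.2.2⟩ : AtomF L n) ∈ φ.atoms}
    fun β hβ => {θ | ∃ ψ ∈ φ.ext β hβ, ∃ (y : Fin (n + 1))
      (hy : y ∉ Set.range (j.trans (incl n.le_succ))), θ = H (α := β) ψ (extend j y hy)}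
termination_by α
decreasing_by exact hβ

/-! ### The recursive description of `Ψ^n_α`, `V` and `H` -/

@[simp] theorem atoms_V {α β : Ordinal.{w}} (h : α ≤ β) {n : ℕ} (φ : Psi L β n) :
    (V h φ).atoms = φ.atoms := atoms_mk _ _

@[simp] theorem ext_V {α β : Ordinal.{w}} (h : α ≤ β) {n : ℕ} (φ : Psi L β n)
    (γ : Ordinal.{w}) (hγ : γ < α) : (V h φ).ext γ hγ = φ.ext γ (hγ.trans_le h) := ext_mk _ _ _ _

theorem V_self {α : Ordinal.{w}} {n : ℕ} (φ : Psi L α n) : V le_rfl φ = φ :=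
  eq_of (by simp) (by simp)

theorem V_V {α β γ : Ordinal.{w}} (h : α ≤ β) (h' : β ≤ γ) {n : ℕ} (φ : Psi L γ n) :
    V h (V h' φ) = V (h.trans h') φ :=
  eq_of (by simp) (by simp)

theorem E_V {α β : Ordinal.{w}} (h : α + 1 ≤ β) {n : ℕ} (φ : Psi L β n) :
    E (V h φ) = φ.ext α ((lt_add_one _).trans_le h) := ext_V _ _ _ _

theorem eq_of_V_of_E {α : Ordinal.{w}} {n : ℕ} {φ ψ : Psi L (α + 1) n}
    (h₁ : V ((lt_add_one α).le) φ = V ((lt_add_one α).le) ψ) (h₂ : E φ = E ψ) : φ = ψ := by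
  refine eq_of (by simpa using congrArg atoms h₁) fun β hβ => ?_
  rcases (Order.lt_add_one_iff.1 hβ).lt_or_eq with h | rfl
  · have := congrArg (fun χ : Psi L α n => χ.ext β h) h₁
    simpa using this
  · exact h₂

/-- A formula in `Ψ^n_0` is given by its atoms. -/
def zeroEquiv (L : FirstOrder.Language.{u, v}) (n : ℕ) :
    Psi L (0 : Ordinal.{w}) n ≃ Set (AtomF L n) where
  toFun φ := φ.atoms
  invFun A := mk A fun _ h => (not_lt_zero h).elim
  left_inv φ := eq_of (by simp) fun _ h => (not_lt_zero h).elim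
  right_inv A := by simp

open Classical in
/-- A formula in `Ψ^n_{α+1}` is given by its first conjunct in `Ψ^n_α` and by an arbitrary subset
`E(φ)` of `Ψ^{n+1}_α`. -/
noncomputable def succEquiv (L : FirstOrder.Language.{u, v}) (α : Ordinal.{w}) (n : ℕ) :
    Psi L (α + 1) n ≃ Psi L α n × Set (Psi L α (n + 1)) where
  toFun φ := (V ((lt_add_one α).le) φ, E φ)
  invFun p := mk p.1.atoms fun β hβ =>
    if h : β < α then p.1.ext β h
    else (le_antisymm (Order.lt_add_one_iff.1 hβ) (not_lt.1 h)) ▸ p.2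
  left_inv φ := by
    refine eq_of (by simp) fun β hβ => ?_
    rcases (Order.lt_add_one_iff.1 hβ).lt_or_eq with h | rfl
    · simp [h]
    · simp [E]
  right_inv p := by
    refine Prod.ext (eq_of (by simp) fun β hβ => ?_) ?_
    · simp [hβ]
    · simp [E]

/-- A formula in `Ψ^n_α`, for limit `α`, is given by a sequence of formulas `ψ_β ∈ Ψ^n_β`, `β < α`,
such that `ψ_β` is the first conjunct of `ψ_{β+1}` and such that, for limit `β`, `ψ_β` is the
conjunction of the `ψ_γ`, `γ < β`. -/
theorem exists_unique_limit {α : Ordinal.{w}} (hα : Order.IsSuccLimit α) {n : ℕ}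
    (ψ : ∀ β : Ordinal.{w}, β < α → Psi L β n)
    (hs : ∀ β (h : β < α), V ((lt_add_one β).le) (ψ (β + 1) (hα.add_one_lt h)) = ψ β h)
    (hl : ∀ β (h : β < α), Order.IsSuccLimit β →
      ∀ γ (h' : γ < β), V h'.le (ψ β h) = ψ γ (h'.trans h)) :
    ∃! φ : Psi L α n, ∀ β (h : β < α), V h.le φ = ψ β h := by
  have coh : ∀ β (h : β < α) γ (h' : γ ≤ β), V h' (ψ β h) = ψ γ (h'.trans_lt h) := by
    intro β
    induction β using Ordinal.limitRecOn with
    | zero => intro h γ h'; obtain rfl : γ = 0 := by simpa using h'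
              exact V_self _
    | add_one β ih =>
      intro h γ h'
      rcases h'.lt_or_eq with h'' | rfl
      · have hb : β < α := (lt_add_one _).trans h
        rw [← V_V (Order.lt_add_one_iff.1 h'') ((lt_add_one β).le), hs β hb]
        exact ih hb γ _
      · exact V_self _
    | limit β hβ _ =>
      intro h γ h'
      rcases h'.lt_or_eq with h'' | rfl
      · exact hl β h hβ γ h''
      · exact V_self _
  have h0 : 0 < α := by
    rcases eq_or_ne α 0 with rfl | h
    · exact (hα.not_isMin (by simp)).elim
    · exact pos_of_ne_zero h
  refine ⟨mk (ψ 0 h0).atoms fun β h => E (ψ (β + 1) (hα.add_one_lt h)), fun β h => ?_, ?_⟩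
  · refine eq_of ?_ fun γ hγ => ?_
    · rw [← coh β h 0 (zero_le)]; simp
    · have := coh β h (γ + 1) (Order.add_one_le_of_lt hγ)
      rw [ext_V, ext_mk, ← this]
      simp [E]
  · intro φ hφ
    refine eq_of ?_ fun β h => ?_
    · rw [← hφ 0 h0]; simp
    · rw [ext_mk, ← hφ (β + 1) (hα.add_one_lt h)]; simp [E]

theorem atoms_H {α : Ordinal.{w}} {m n : ℕ} (φ : Psi L α n) (j : Fin m ↪ Fin n) :
    (H φ j).atoms = {A | (⟨A.1, A.2.1, j ∘ A.2.2⟩ : AtomF L n) ∈ φ.atoms} := by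
  rw [H, atoms_mk]

theorem ext_H {α : Ordinal.{w}} {m n : ℕ} (φ : Psi L α n) (j : Fin m ↪ Fin n)
    (β : Ordinal.{w}) (hβ : β < α) :
    (H φ j).ext β hβ = {θ | ∃ ψ ∈ φ.ext β hβ, ∃ (y : Fin (n + 1))
      (hy : y ∉ Set.range (j.trans (incl n.le_succ))), θ = H ψ (extend j y hy)} := by
  rw [H, ext_mk]

/-- The successor and limit clauses for `H`, first part. -/
theorem V_H {α β : Ordinal.{w}} (h : α ≤ β) {m n : ℕ} (φ : Psi L β n) (j : Fin m ↪ Fin n) :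
    V h (H φ j) = H (V h φ) j :=
  eq_of (by simp [atoms_H]) fun γ hγ => by simp [ext_H]

/-- The successor clause for `H`, second part. -/
theorem E_H {α : Ordinal.{w}} {m n : ℕ} (φ : Psi L (α + 1) n) (j : Fin m ↪ Fin n) :
    E (H φ j) = {θ | ∃ ψ ∈ E φ, ∃ (y : Fin (n + 1))
      (hy : y ∉ Set.range (j.trans (incl n.le_succ))), θ = H ψ (extend j y hy)} :=
  ext_H _ _ _ _

end Psi

/-! ## The infinitary formulas written out -/

/-- Formulas of `𝓛_{∞,ω}` over a relational vocabulary, with variables `x_i`, `i ∈ ℕ`. -/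
inductive InfFormula (L : FirstOrder.Language.{u, v}) : Type (max v (w + 1) + 1)
  | rel {k : ℕ} (R : L.Relations k) (f : Fin k → ℕ) : InfFormula L
  | eq (i j : ℕ) : InfFormula L
  | not (φ : InfFormula L) : InfFormula L
  | imp (φ ψ : InfFormula L) : InfFormula L
  | conj {ι : Type (max v (w + 1))} (f : ι → InfFormula L) : InfFormula L
  | disj {ι : Type (max v (w + 1))} (f : ι → InfFormula L) : InfFormula L
  | ex (i : ℕ) (φ : InfFormula L) : InfFormula L
  | all (i : ℕ) (φ : InfFormula L) : InfFormula L

namespace Psi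

variable {L : FirstOrder.Language.{u, v}}

/-- Binary conjunction. -/
def InfAnd (φ ψ : InfFormula.{u, v, w} L) : InfFormula.{u, v, w} L :=
  .conj fun b : ULift.{max v (w + 1)} Bool => cond b.down φ ψ

open Classical in
/-- The complete conjunction over `X_n` with positive relational atoms `A`. -/
noncomputable def literals {n : ℕ} (A : Set (AtomF L n)) : InfFormula.{u, v, w} L :=
  InfAnd
    (.conj fun a : ULift.{max v (w + 1)} (AtomF L n) =>
      if a.down ∈ A then .rel a.down.2.1 (fun i => a.down.2.2 i)
      else .not (.rel a.down.2.1 (fun i => a.down.2.2 i)))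
    (.conj fun p : ULift.{max v (w + 1)} (Fin n × Fin n) =>
      if p.down.1 = p.down.2 then .eq p.down.1 p.down.2 else .not (.eq p.down.1 p.down.2))

/-- The infinitary formula that an element of `Ψ^n_α` stands for. -/
noncomputable def toFormula (α : Ordinal.{w}) :
    ∀ n : ℕ, Psi L α n → InfFormula.{u, v, w} L :=
  Ordinal.limitRecOn (motive := fun α => ∀ n : ℕ, Psi L α n → InfFormula.{u, v, w} L) α
    (fun _ φ => literals φ.atoms)
    (fun α F n φ =>
      InfAnd (F n (V ((lt_add_one α).le) φ))
        (InfAnd (.conj fun ψ : E φ => .ex n (F (n + 1) ψ))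
          (.all n (.imp
            (.conj fun i : ULift.{max v (w + 1)} (Fin n) => .not (.eq n i.down))
            (.disj fun ψ : E φ => F (n + 1) ψ)))))
    (fun α _ F n φ =>
      .conj fun β : ULift.{max v (w + 1)} (Set.Iio α) => F β.down.1 β.down.2 n
        (V (le_of_lt β.down.2) φ))

theorem toFormula_zero {n : ℕ} (φ : Psi L (0 : Ordinal.{w}) n) :
    toFormula 0 n φ = literals φ.atoms := by
  rw [toFormula, Ordinal.limitRecOn_zero]

theorem toFormula_add_one {α : Ordinal.{w}} {n : ℕ} (φ : Psi L (α + 1) n) :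
    toFormula (α + 1) n φ =
      InfAnd (toFormula α n (V (lt_add_one α).le φ))
        (InfAnd (.conj fun ψ : E φ => .ex n (toFormula α (n + 1) ψ))
          (.all n (.imp
            (.conj fun i : ULift.{max v (w + 1)} (Fin n) => .not (.eq n i.down))
            (.disj fun ψ : E φ => toFormula α (n + 1) ψ)))) := by
  rw [toFormula, Ordinal.limitRecOn_add_one]; rfl

theorem toFormula_limit {α : Ordinal.{w}} (hα : Order.IsSuccLimit α) {n : ℕ} (φ : Psi L α n) :
    toFormula α n φ = .conj fun β : ULift.{max v (w + 1)} (Set.Iio α) =>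
      toFormula β.down.1 n (V (le_of_lt β.down.2) φ) := by
  rw [toFormula, Ordinal.limitRecOn_limit _ _ _ _ hα]; rfl

theorem InfAnd_inj {φ ψ φ' ψ' : InfFormula.{u, v, w} L} (h : InfAnd φ ψ = InfAnd φ' ψ') :
    φ = φ' ∧ ψ = ψ' := by
  simp only [InfAnd, InfFormula.conj.injEq, heq_eq_eq, true_and] at h
  exact ⟨congrFun h ⟨true⟩, congrFun h ⟨false⟩⟩

theorem literals_injective {n : ℕ} :
    Function.Injective (literals.{u, v, w} (L := L) (n := n)) := by
  intro A B h
  have h := (InfAnd_inj h).1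
  simp only [InfFormula.conj.injEq, heq_eq_eq, true_and] at h
  ext a
  have := congrFun h ⟨a⟩
  by_cases ha : a ∈ A <;> by_cases hb : a ∈ B <;> simp_all

/-- Different elements of `Ψ^n_α` stand for different formulas. -/
theorem toFormula_injective (α : Ordinal.{w}) :
    ∀ n, Function.Injective (toFormula (L := L) α n) := by
  induction α using Ordinal.limitRecOn with
  | zero =>
    intro n φ ψ h
    rw [toFormula_zero, toFormula_zero] at h
    exact (zeroEquiv L n).injective (literals_injective h)
  | add_one α ih =>
    intro n φ ψ h
    rw [toFormula_add_one, toFormula_add_one] at h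
    obtain ⟨h₁, h₂⟩ := InfAnd_inj h
    refine eq_of_V_of_E (ih n h₁) ?_
    have h₃ := (InfAnd_inj h₂).2
    simp only [InfFormula.all.injEq, InfFormula.imp.injEq, true_and] at h₃
    have key : ∀ {ι κ : Type (max v (w + 1))} {f : ι → InfFormula.{u, v, w} L}
        {g : κ → InfFormula.{u, v, w} L}, InfFormula.disj f = InfFormula.disj g →
        Set.range f = Set.range g := by
      intro ι κ f g hfg
      simp only [InfFormula.disj.injEq] at hfg
      obtain ⟨rfl, hfg⟩ := hfg
      rw [eq_of_heq hfg]
    have h₄ := key h₃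
    have h₅ : ∀ χ : Psi L (α + 1) n, (Set.range fun θ : E χ => toFormula α (n + 1) θ) =
        toFormula α (n + 1) '' E χ := by
      intro χ; ext; simp
    rw [h₅, h₅] at h₄
    exact (ih (n + 1)).image_injective h₄
  | limit α hα ih =>
    intro n φ ψ h
    rw [toFormula_limit hα, toFormula_limit hα] at h
    simp only [InfFormula.conj.injEq, heq_eq_eq, true_and] at h
    have hV : ∀ β (hβ : β < α), V hβ.le φ = V hβ.le ψ := fun β hβ =>
      ih β hβ n (congrFun h ⟨⟨β, hβ⟩⟩)
    exact (exists_unique_limit hα (fun β hβ => V hβ.le ψ) (fun _ _ => V_V _ _ _)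
      fun _ _ _ _ _ => V_V _ _ _).unique hV fun _ _ => rfl

end Psi

open Psi

/-! ## Scott formulas of a structure -/

/-- The Scott formula `φ^M_{a,α}` of a tuple `a` of distinct elements of `M`: it decides the atomic
formulas as `a` does in `M`, and `E` of its projection to level `β + 1` is the set of all
`φ^M_{a⌢c,β}`, where `c` ranges over the elements of `M` that are not in `a`. -/
def scottFormula {L : FirstOrder.Language.{u, v}} {M : Type x} [L.Structure M]
    (α : Ordinal.{w}) {n : ℕ} (a : Fin n ↪ M) : Psi L α n :=
  mk {A | FirstOrder.Language.Structure.RelMap A.2.1 (a ∘ A.2.2)}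
    fun β hβ => {θ | ∃ (c : M) (hc : c ∉ Set.range a),
      θ = scottFormula β (Fin.Embedding.snoc a hc)}
termination_by α
decreasing_by exact hβ

/-- The first conjunct of `φ^M_{a,α+1}` is `φ^M_{a,α}`, and `φ^M_{a,α}` is the conjunction of the
`φ^M_{a,β}`, `β < α`, for limit `α`. -/
theorem V_scottFormula {L : FirstOrder.Language.{u, v}} {M : Type x} [L.Structure M]
    {α β : Ordinal.{w}} (h : α ≤ β) {n : ℕ} (a : Fin n ↪ M) :
    V h (scottFormula (L := L) β a) = scottFormula α a := by
  rw [scottFormula, scottFormula]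
  exact eq_of (by simp) (by simp)

theorem E_scottFormula {L : FirstOrder.Language.{u, v}} {M : Type x} [L.Structure M]
    {α : Ordinal.{w}} {n : ℕ} (a : Fin n ↪ M) :
    E (scottFormula (L := L) (α + 1) a) = {θ | ∃ (c : M) (hc : c ∉ Set.range a),
      θ = scottFormula α (Fin.Embedding.snoc a hc)} := by
  rw [scottFormula, E, ext_mk]

/-- The set `Φ^n_α(M) = Φ_α(M) ∩ Ψ^n_α`. -/
def scottLevel (L : FirstOrder.Language.{u, v}) (M : Type x) [L.Structure M]
    (α : Ordinal.{w}) (n : ℕ) : Set (Psi L α n) :=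
  Set.range fun a : Fin n ↪ M => scottFormula α a

/-! ## Scott processes

A sequence of sets `Φ_α ⊆ Ψ_α = ⋃_n Ψ^n_α` is given by the sets `Φ^n_α = Φ_α ∩ Ψ^n_α`; as the
`Ψ^n_α` are disjoint for distinct `n`, the set `Φ_α` itself is `Σ n, Φ α n`. Only the levels below
the length matter. -/

/-- `⟨Φ_α : α < ℓ⟩` is a Scott process. -/
structure IsScottProc {L : FirstOrder.Language.{u, v}} (ℓ : Ordinal.{w})
    (Φ : ∀ (α : Ordinal.{w}) (n : ℕ), Set (Psi L α n)) : Prop where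
  /-- `E(φ) ⊆ Φ_α` for `φ ∈ Φ_{α+1}`. -/
  E_subset : ∀ α, α + 1 < ℓ → ∀ n, ∀ φ ∈ Φ (α + 1) n, E φ ⊆ Φ α (n + 1)
  /-- `Φ_α = V_{α,β}[Φ_β]` for `α < β`. -/
  eq_image_V : ∀ α β, ∀ h : α < β, β < ℓ → ∀ n, Φ α n = V h.le '' Φ β n
  /-- Each level is closed under permutations of the variables. -/
  H_mem : ∀ α, α < ℓ → ∀ n, ∀ j : Fin n ↪ Fin n, ∀ φ ∈ Φ α n, H φ j ∈ Φ α n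
  /-- `Φ^m_α = H^n_α[Φ^n_α × {i_m}]` for `m < n`. -/
  eq_image_H : ∀ α, α < ℓ → ∀ m n, ∀ h : m < n,
    Φ α m = (fun φ => H φ (incl h.le)) '' Φ α n
  /-- `E(φ) = V_{α,α+1}[{ψ ∈ Φ^{n+1}_{α+1} | H(ψ, i_n) = φ}]` for `φ ∈ Φ^n_{α+1}`. -/
  E_eq : ∀ α, α + 1 < ℓ → ∀ n, ∀ φ ∈ Φ (α + 1) n,
    E φ = V (lt_add_one α).le '' {ψ ∈ Φ (α + 1) (n + 1) | H ψ (incl n.le_succ) = φ}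
  /-- `E(V_{α+1,β}(φ)) ⊆ V_{α,β}[{ψ ∈ Φ^{n+1}_β | H(ψ, i_n) = φ}]` for `α < β`, `φ ∈ Φ^n_β`. -/
  E_V_subset : ∀ α β, ∀ h : α < β, β < ℓ → ∀ n, ∀ φ ∈ Φ β n,
    E (V (Order.add_one_le_of_lt h) φ) ⊆
      V h.le '' {ψ ∈ Φ β (n + 1) | H ψ (incl n.le_succ) = φ}
  /-- Any two formulas of a level are projections of one formula of that level. -/
  combine : ∀ α, α < ℓ → ∀ n m, ∀ φ ∈ Φ α n, ∀ ψ ∈ Φ α m,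
    ∃ θ ∈ Φ α (n + m), ∃ j : Fin m ↪ Fin (n + m),
      φ = H θ (incl (Nat.le_add_right n m)) ∧ ψ = H θ j

/-- The amalgamation property of a set `Φ ⊆ Ψ_δ`. -/
def Amalgamates {L : FirstOrder.Language.{u, v}} {δ : Ordinal.{w}}
    (Φ : ∀ n : ℕ, Set (Psi L δ n)) : Prop :=
  ∀ (m n : ℕ) (h : m < n), ∀ φ ∈ Φ (m + 1), ∀ ψ ∈ Φ n,
    H φ (incl m.le_succ) = H ψ (incl h.le) →
      ∃ θ ∈ Φ (n + 1), ∃ (y : Fin (n + 1))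
        (hy : y ∉ Set.range ((incl h.le).trans (incl n.le_succ))),
        H θ (extend (incl h.le) y hy) = φ ∧ H θ (incl n.le_succ) = ψ

/-- `M` is a model of `⟨Φ_α : α < ℓ⟩`, that is, `Φ_α = Φ_α(M)` for all `α < ℓ`. -/
def IsModelOf {L : FirstOrder.Language.{u, v}} (M : Type x) [L.Structure M] (ℓ : Ordinal.{w})
    (Φ : ∀ (α : Ordinal.{w}) (n : ℕ), Set (Psi L α n)) : Prop :=
  ∀ α, α < ℓ → ∀ n, Φ α n = scottLevel L M α n

end ScottAnalysis

namespace ScottAnalysis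

variable {L : FirstOrder.Language.{u, v}}

/-! The model is built as a coherent assignment of formulas of `Φ δ` to finite tuples of distinct
points of `ω₁`. Order typed tuples by subtuple together with horizontal projection. An ideal `J`
then assigns exactly one formula to each finite tuple from its domain, and so is a partial model. If
`J` is full, meaning that every one-point extension of an assigned formula is realized, it defines a
structure in which each tuple has its assigned formula as Scott formula (`scottFormula_modelOf`),
and every formula of `Φ δ` occurs (`exists_tuple_of_mem`).

The heart is `exists_realizing_extension`: over a partial model with countable domain, a missing
formula is realized by adding one point `c`. The conditions are the typings of `c` over finite
tuples of `J`. Amalgamation lets each old point `d` be absorbed into a condition, unless `c` gets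
identified with `d`, in which case `d` already realized the formula. Countably many dense sets have
to be met, so a generic ideal exists.

Since `Φ δ` has at most `ℵ₁` formulas, the realization tasks over tuples from `ω₁` can be numbered
by `ω₁`. Treating one number at each stage keeps every proper stage countable, and the union is full
(`exists_isFull`). Amalgamation over countable partial models is thus all that is needed, which is
why the bound is `ℵ₁`. -/

@[simp] theorem extend_castSucc {m n : ℕ} (j : Fin m ↪ Fin n) (y : Fin (n + 1))
    (hy : y ∉ Set.range (j.trans (incl n.le_succ))) (i : Fin m) :
    extend j y hy i.castSucc = (j i).castSucc :=
  Fin.Embedding.snoc_castSucc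

@[simp] theorem extend_last {m n : ℕ} (j : Fin m ↪ Fin n) (y : Fin (n + 1))
    (hy : y ∉ Set.range (j.trans (incl n.le_succ))) : extend j y hy (Fin.last m) = y :=
  Fin.Embedding.snoc_last

/-- Embeddings out of `Fin (n + 1)` agree if they agree on the first `n` points and on the last. -/
theorem embedding_ext_snoc {n : ℕ} {X : Type*} {f g : Fin (n + 1) ↪ X}
    (h : ∀ i : Fin n, f i.castSucc = g i.castSucc) (hl : f (Fin.last n) = g (Fin.last n)) :
    f = g := by
  ext i
  induction i using Fin.lastCases with
  | last => exact hl
  | cast i => exact h i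

/-! ### Functoriality of the horizontal projections -/

namespace Psi

theorem H_refl {α : Ordinal.{w}} {n : ℕ} (φ : Psi L α n) :
    H φ (Function.Embedding.refl (Fin n)) = φ := by
  induction α using WellFoundedLT.induction generalizing n with
  | ind α ih =>
    have key : ∀ (y : Fin (n + 1))
        (hy : y ∉ Set.range ((Function.Embedding.refl (Fin n)).trans (incl n.le_succ))),
        extend (Function.Embedding.refl (Fin n)) y hy = Function.Embedding.refl _ := by
      intro y hy
      refine embedding_ext_snoc (fun i => by simp) ?_
      rw [extend_last]
      induction y using Fin.lastCases with
      | last => rfl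
      | cast i => exact (hy ⟨i, rfl⟩).elim
    refine eq_of ?_ fun β hβ => ?_
    · rw [atoms_H]; rfl
    · rw [ext_H]
      ext θ
      constructor
      · rintro ⟨ψ, hψ, y, hy, rfl⟩
        rw [key, ih β hβ]
        exact hψ
      · intro hθ
        refine ⟨θ, hθ, Fin.last n, ?_, ?_⟩
        · rintro ⟨i, hi⟩
          exact (Fin.castSucc_lt_last i).ne hi
        · rw [key, ih β hβ]

theorem H_trans {α : Ordinal.{w}} {l m n : ℕ} (φ : Psi L α n) (j : Fin m ↪ Fin n)
    (k : Fin l ↪ Fin m) : H (H φ j) k = H φ (k.trans j) := by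
  induction α using WellFoundedLT.induction generalizing l m n with
  | ind α ih =>
    refine eq_of ?_ fun β hβ => ?_
    · simp only [atoms_H]; rfl
    · simp only [ext_H]
      ext θ
      constructor
      · rintro ⟨_, ⟨ψ, hψ, y, hy, rfl⟩, z, hz, rfl⟩
        rw [ih β hβ]
        refine ⟨ψ, hψ, extend j y hy z, ?_, ?_⟩
        · rintro ⟨i, hi⟩
          refine hz ⟨i, (extend j y hy).injective ?_⟩
          rw [← hi]
          exact extend_castSucc j y hy (k i)
        · congr 1
          exact embedding_ext_snoc (fun i => by simp) (by simp)
      · rintro ⟨ψ, hψ, w, hw, rfl⟩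
        -- If `w = j z`, the intermediate projection spends its new variable on the unused `Fin.last
        -- n`, and `w` is recovered as the old variable `z`. Otherwise `w` itself is the new
        -- variable.
        by_cases hwj : w ∈ Set.range (j.trans (incl n.le_succ))
        · obtain ⟨z, rfl⟩ := hwj
          have hlast : Fin.last n ∉ Set.range (j.trans (incl n.le_succ)) := by
            rintro ⟨i, hi⟩
            exact (Fin.castSucc_lt_last (j i)).ne hi
          refine ⟨_, ⟨ψ, hψ, Fin.last n, hlast, rfl⟩, z.castSucc, ?_, ?_⟩
          · rintro ⟨i, hi⟩
            refine hw ⟨i, ?_⟩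
            have : k i = z := Fin.castSucc_injective _ hi
            simp [this]
          · rw [ih β hβ]
            congr 1
            exact embedding_ext_snoc (fun i => by simp) (by simp; rfl)
        · refine ⟨_, ⟨ψ, hψ, w, hwj, rfl⟩, Fin.last m, ?_, ?_⟩
          · rintro ⟨i, hi⟩
            exact (Fin.castSucc_lt_last (k i)).ne hi
          · rw [ih β hβ]
            congr 1
            exact embedding_ext_snoc (fun i => by simp) (by simp)

end Psi

open Psi

/-- An injection between initial segments is an inclusion followed by a permutation. -/
theorem exists_incl_trans_perm {m n : ℕ} (j : Fin m ↪ Fin n) (h : m ≤ n) :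
    ∃ σ : Fin n ↪ Fin n, j = (incl h).trans σ := by
  classical
  let e : {x : Fin n // x ∈ Set.range (incl h)} ≃ {x : Fin n // x ∈ Set.range j} :=
    (Equiv.ofInjective _ (incl h).injective).symm.trans (Equiv.ofInjective _ j.injective)
  refine ⟨e.extendSubtype.toEmbedding, ?_⟩
  ext i
  have : e.extendSubtype (incl h i) = j i := by
    rw [Equiv.extendSubtype_apply_of_mem e _ ⟨i, rfl⟩]
    simp only [e, Equiv.trans_apply]
    have : (Equiv.ofInjective _ (incl h).injective).symm ⟨incl h i, i, rfl⟩ = i :=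
      Equiv.ofInjective_symm_apply (incl h).injective i
    rw [this]
    rfl
  exact congrArg Fin.val this.symm

/-- Conditions 3 and 4 cover permutations and inclusions, and every injection factors through these
two. -/
theorem IsScottProc.H_mem' {ℓ : Ordinal.{w}} {Φ : ∀ (α : Ordinal.{w}) (n : ℕ), Set (Psi L α n)}
    (hΦ : IsScottProc ℓ Φ) {α : Ordinal.{w}} (hα : α < ℓ) {m n : ℕ} (j : Fin m ↪ Fin n)
    {φ : Psi L α n} (hφ : φ ∈ Φ α n) : H φ j ∈ Φ α m := by
  have hmn : m ≤ n := by simpa using Fintype.card_le_of_embedding j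
  rcases hmn.lt_or_eq with h | rfl
  · obtain ⟨σ, rfl⟩ := exists_incl_trans_perm j hmn
    rw [← H_trans, hΦ.eq_image_H α hα m n h]
    exact ⟨_, hΦ.H_mem α hα n σ φ hφ, rfl⟩
  · exact hΦ.H_mem α hα m j φ hφ

/-! ## Partial models -/

/-- A finite tuple of distinct elements of `X` together with a formula assigned to it. -/
structure TypedTuple (X : Type x) {δ : Ordinal.{w}} (Φ : ∀ n : ℕ, Set (Psi L δ n)) where
  size : ℕ
  tuple : Fin size ↪ X
  type : Psi L δ size
  type_mem : type ∈ Φ size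

namespace TypedTuple

variable {X : Type x} {δ : Ordinal.{w}} {Φ : ∀ n : ℕ, Set (Psi L δ n)}

/-- This is only a preorder: permuting entries and variables together gives an equivalent typed
tuple. Ideals are the partial models. -/
instance : Preorder (TypedTuple X Φ) where
  le p q := ∃ j : Fin p.size ↪ Fin q.size, p.tuple = j.trans q.tuple ∧ p.type = H q.type j
  le_refl p := ⟨Function.Embedding.refl _, rfl, (H_refl _).symm⟩
  le_trans p q r := by
    rintro ⟨j, hj, hj'⟩ ⟨k, hk, hk'⟩
    exact ⟨j.trans k, by rw [hj, hk]; rfl, by rw [hj', hk', H_trans]⟩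

/-- The set of entries of a typed tuple. -/
abbrev support (p : TypedTuple X Φ) : Set X := Set.range p.tuple

theorem support_mono {p q : TypedTuple X Φ} (h : p ≤ q) : p.support ⊆ q.support := by
  obtain ⟨j, hj, -⟩ := h
  rintro _ ⟨i, rfl⟩
  exact ⟨j i, by rw [hj]; rfl⟩

end TypedTuple

/-- The set of entries of the members of a family of typed tuples. -/
def dom {X : Type x} {δ : Ordinal.{w}} {Φ : ∀ n : ℕ, Set (Psi L δ n)} (J : Set (TypedTuple X Φ)) :
    Set X := ⋃ p ∈ J, p.support

section Ideal

variable {X : Type x} {δ : Ordinal.{w}} {Φ : ∀ n : ℕ, Set (Psi L δ n)} {J : Set (TypedTuple X Φ)}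

theorem mem_dom {c : X} : c ∈ dom J ↔ ∃ p ∈ J, c ∈ p.support := by simp [dom]

theorem support_subset_dom {p : TypedTuple X Φ} (hp : p ∈ J) : p.support ⊆ dom J :=
  fun _ hc => mem_dom.2 ⟨p, hp, hc⟩

/-- Both types are projections of the type of a common upper bound, whose entries are distinct, so
the injection matching the entries also matches the types. Within a directed family the order is
therefore inclusion of supports. -/
theorem le_of_support_subset (hJ : DirectedOn (· ≤ ·) J) {p q : TypedTuple X Φ} (hp : p ∈ J)
    (hq : q ∈ J) (h : p.support ⊆ q.support) : p ≤ q := by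
  obtain ⟨s, -, ⟨k, hk, hk'⟩, l, hl, hl'⟩ := hJ p hp q hq
  choose f hf using fun i : Fin p.size => h ⟨i, rfl⟩
  have hf' : Function.Injective f := fun i i' hii => p.tuple.injective (by rw [← hf, ← hf, hii])
  refine ⟨⟨f, hf'⟩, ?_, ?_⟩
  · ext i
    exact (hf i).symm
  · rw [hk', hl', H_trans]
    congr 1
    ext i
    refine congrArg Fin.val (s.tuple.injective ?_)
    have h1 : p.tuple i = s.tuple (k i) := by rw [hk]; rfl
    have h2 : q.tuple (f i) = s.tuple (l (f i)) := by rw [hl]; rfl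
    rw [← h1, ← hf, h2]
    rfl

theorem type_unique (hJ : DirectedOn (· ≤ ·) J) {n : ℕ} {b : Fin n ↪ X} {θ θ' : Psi L δ n}
    {h : θ ∈ Φ n} {h' : θ' ∈ Φ n} (hp : (⟨n, b, θ, h⟩ : TypedTuple X Φ) ∈ J)
    (hq : (⟨n, b, θ', h'⟩ : TypedTuple X Φ) ∈ J) : θ = θ' := by
  obtain ⟨j, hj, hj'⟩ := le_of_support_subset hJ hp hq subset_rfl
  have : j = Function.Embedding.refl _ := by
    ext i
    refine congrArg Fin.val (b.injective ?_)
    exact (DFunLike.congr_fun hj i).symm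
  rw [this, H_refl] at hj'
  exact hj'

theorem exists_support_superset (hne : J.Nonempty) (hJ : DirectedOn (· ≤ ·) J) {F : Set X}
    (hF : F.Finite) (h : F ⊆ dom J) : ∃ p ∈ J, F ⊆ p.support := by
  have hd : DirectedOn (fun p q : TypedTuple X Φ => p.support ⊆ q.support) J := fun p hp q hq => by
    obtain ⟨s, hs, h1, h2⟩ := hJ p hp q hq
    exact ⟨s, hs, TypedTuple.support_mono h1, TypedTuple.support_mono h2⟩
  lift F to Finset X using hF
  exact hd.exists_mem_subset_of_finset_subset_biUnion hne h

/-- By directedness one member contains all entries of `b`, and its projection stays in the lower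
set. With `type_unique`, an ideal is a function on the finite tuples of its domain. -/
theorem exists_type_of_subset_dom (hJ : Order.IsIdeal J)
    (hH : ∀ (m n : ℕ) (j : Fin m ↪ Fin n), ∀ φ ∈ Φ n, H φ j ∈ Φ m) {n : ℕ} (b : Fin n ↪ X)
    (h : Set.range b ⊆ dom J) : ∃ θ, ∃ hθ : θ ∈ Φ n, (⟨n, b, θ, hθ⟩ : TypedTuple X Φ) ∈ J := by
  obtain ⟨p, hp, hb⟩ := exists_support_superset hJ.Nonempty hJ.Directed (Set.finite_range b) h
  choose f hf using fun i : Fin n => hb ⟨i, rfl⟩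
  have hf' : Function.Injective f := fun i i' hii => b.injective (by rw [← hf, ← hf, hii])
  refine ⟨H p.type ⟨f, hf'⟩, hH _ _ _ _ p.type_mem, hJ.IsLowerSet ?_ hp⟩
  refine ⟨⟨f, hf'⟩, ?_, rfl⟩
  ext i
  exact (hf i).symm

end Ideal

/-! ## Realizing one formula over a countable partial model -/

section Extension

variable {X : Type x} {δ : Ordinal.{w}} {Φ : ∀ n : ℕ, Set (Psi L δ n)} {J : Set (TypedTuple X Φ)}

/-- Some one-point extension of the tuple `b` is assigned the formula `φ`. -/
def Realizes (J : Set (TypedTuple X Φ)) {n : ℕ} (b : Fin n ↪ X) (φ : Psi L δ (n + 1)) : Prop :=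
  ∃ (d : X) (hd : d ∉ Set.range b) (hφ : φ ∈ Φ (n + 1)),
    (⟨n + 1, Fin.Embedding.snoc b hd, φ, hφ⟩ : TypedTuple X Φ) ∈ J

theorem Realizes.mono {K : Set (TypedTuple X Φ)} (h : J ⊆ K) {n : ℕ} {b : Fin n ↪ X}
    {φ : Psi L δ (n + 1)} : Realizes J b φ → Realizes K b φ := by
  rintro ⟨d, hd, hφ, hJ⟩
  exact ⟨d, hd, hφ, h hJ⟩

/-- The typed tuple `q` with the new point `c` put at the end. -/
abbrev TypedTuple.snoc (q : TypedTuple X Φ) (c : X) (hc : c ∉ q.support)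
    (θ : Psi L δ (q.size + 1)) (hθ : θ ∈ Φ (q.size + 1)) : TypedTuple X Φ :=
  ⟨q.size + 1, Fin.Embedding.snoc q.tuple hc, θ, hθ⟩

theorem TypedTuple.support_snoc (q : TypedTuple X Φ) (c : X) (hc : c ∉ q.support)
    (θ : Psi L δ (q.size + 1)) (hθ : θ ∈ Φ (q.size + 1)) :
    (q.snoc c hc θ hθ).support = insert c q.support := by
  ext d
  constructor
  · rintro ⟨i, rfl⟩
    change Fin.Embedding.snoc q.tuple hc i ∈ _
    induction i using Fin.lastCases with
    | last => exact Or.inl Fin.Embedding.snoc_last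
    | cast i => exact Or.inr ⟨i, Fin.Embedding.snoc_castSucc.symm⟩
  · rintro (rfl | ⟨i, rfl⟩)
    · exact ⟨Fin.last _, Fin.Embedding.snoc_last (ha := hc)⟩
    · exact ⟨i.castSucc, Fin.Embedding.snoc_castSucc (ha := hc)⟩

/-- The type of an initial segment is the projection of the type. -/
theorem le_snoc (q : TypedTuple X Φ) (c : X) (hc : c ∉ q.support)
    (θ : Psi L δ (q.size + 1)) (hθ : θ ∈ Φ (q.size + 1))
    (h : H θ (incl q.size.le_succ) = q.type) : q ≤ q.snoc c hc θ hθ := by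
  refine ⟨incl q.size.le_succ, ?_, h.symm⟩
  ext i
  exact (Fin.Embedding.snoc_castSucc (ha := hc)).symm

theorem H_incl_eq_of_le_snoc {q : TypedTuple X Φ} {c : X} {hc : c ∉ q.support}
    {θ : Psi L δ (q.size + 1)} {hθ : θ ∈ Φ (q.size + 1)} (h : q ≤ q.snoc c hc θ hθ) :
    H θ (incl q.size.le_succ) = q.type := by
  obtain ⟨j, hj, hj'⟩ := h
  have : j = incl q.size.le_succ := by
    ext i
    refine congrArg Fin.val ((q.snoc c hc θ hθ).tuple.injective ?_)
    exact (DFunLike.congr_fun hj i).symm.trans (Fin.Embedding.snoc_castSucc (ha := hc)).symm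
  rw [hj', this]

/-- A formula `θ` over `q` either is realized by `d`, or is consistent with adding `d`
to `q`. -/
theorem exists_amalgam (hA : Amalgamates Φ) (hJ : Order.IsIdeal J)
    (hH : ∀ (m n : ℕ) (j : Fin m ↪ Fin n), ∀ φ ∈ Φ n, H φ j ∈ Φ m)
    {q : TypedTuple X Φ} (hq : q ∈ J) {c : X} (hc : c ∉ dom J) (hcq : c ∉ q.support)
    {θ : Psi L δ (q.size + 1)} (hθ : θ ∈ Φ (q.size + 1))
    (hθq : H θ (incl q.size.le_succ) = q.type) {d : X} (hd : d ∈ dom J) :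
    (∃ hd : d ∉ q.support, q.snoc d hd θ hθ ∈ J) ∨
      ∃ q' ∈ J, ∃ (hcq' : c ∉ q'.support) (χ : Psi L δ (q'.size + 1)) (hχ : χ ∈ Φ (q'.size + 1)),
        H χ (incl q'.size.le_succ) = q'.type ∧
        q.snoc c hcq θ hθ ≤ q'.snoc c hcq' χ hχ ∧ d ∈ q'.support := by
  by_cases hdq : d ∈ q.support
  · exact Or.inr ⟨q, hq, hcq, θ, hθ, hθq, le_rfl, hdq⟩
  have hsub : Set.range (Fin.Embedding.snoc q.tuple hdq) ⊆ dom J := by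
    rintro _ ⟨i, rfl⟩
    induction i using Fin.lastCases with
    | last => rwa [Fin.Embedding.snoc_last]
    | cast i =>
      rw [Fin.Embedding.snoc_castSucc]
      exact support_subset_dom hq ⟨i, rfl⟩
  obtain ⟨ψ, hψ, hψJ⟩ := exists_type_of_subset_dom hJ hH _ hsub
  change q.snoc d hdq ψ hψ ∈ J at hψJ
  have hψq := H_incl_eq_of_le_snoc (le_of_support_subset hJ.Directed hq hψJ
    (by rw [TypedTuple.support_snoc]; exact Set.subset_insert _ _))
  obtain ⟨χ, hχ, y, hy, h1, h2⟩ := hA q.size (q.size + 1) (Nat.lt_succ_self _) θ hθ ψ hψ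
    (hθq.trans hψq.symm)
  -- As `y` avoids the variables of `q`, two cases remain. If `y` is last, the new point is distinct
  -- from `d` and `χ` types `c` over `q⌢d`. Otherwise `y` is the variable of `d`, and `θ = ψ` is the
  -- type of `q⌢d`.
  induction y using Fin.lastCases with
  | last =>
    right
    have hcq' : c ∉ (q.snoc d hdq ψ hψ).support := fun h => hc (support_subset_dom hψJ h)
    refine ⟨q.snoc d hdq ψ hψ, hψJ, hcq', χ, hχ, h2, ⟨extend _ _ hy, ?_, h1.symm⟩, ?_⟩
    · refine embedding_ext_snoc (fun i => ?_) ?_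
      · refine (Fin.Embedding.snoc_castSucc (ha := hcq)).trans ?_
        change _ = Fin.Embedding.snoc _ hcq' (extend _ _ hy i.castSucc)
        rw [extend_castSucc, Fin.Embedding.snoc_castSucc]
        exact (Fin.Embedding.snoc_castSucc (ha := hdq)).symm
      · refine (Fin.Embedding.snoc_last (ha := hcq)).trans ?_
        change _ = Fin.Embedding.snoc _ hcq' (extend _ _ hy (Fin.last _))
        rw [extend_last, Fin.Embedding.snoc_last]
    · rw [TypedTuple.support_snoc]
      exact Set.mem_insert _ _
  | cast y =>
    left
    induction y using Fin.lastCases with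
    | last =>
      have : extend (incl (Nat.lt_succ_self q.size).le) _ hy = incl (q.size + 1).le_succ :=
        embedding_ext_snoc (fun i => by rw [extend_castSucc]; rfl) (by rw [extend_last]; rfl)
      rw [this, h2] at h1
      subst h1
      exact ⟨hdq, hψJ⟩
    | cast y => exact (hy ⟨y, rfl⟩).elim

/-- The generic ideal lives in a set `C` of conditions that need not be downward closed; its lower
closure is the partial model. -/
theorem isIdeal_lowerClosure_image {P : Type*} [Preorder P] {C : Set P} (G : Order.Ideal C) :
    Order.IsIdeal {p : P | ∃ r ∈ G, p ≤ (r : P)} where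
  IsLowerSet := by
    rintro p q hqp ⟨r, hr, h⟩
    exact ⟨r, hr, hqp.trans h⟩
  Nonempty := by
    obtain ⟨r, hr⟩ := G.nonempty
    exact ⟨r, r, hr, le_rfl⟩
  Directed := by
    rintro p ⟨r, hr, h⟩ p' ⟨r', hr', h'⟩
    obtain ⟨s, hs, h1, h2⟩ := G.directed r hr r' hr'
    exact ⟨s, ⟨s, hs, le_rfl⟩, h.trans h1, h'.trans h2⟩

/-- Over a countable partial model every formula is realized in an extension by at most one
point. -/
theorem exists_realizing_extension (hA : Amalgamates Φ) (hJ : Order.IsIdeal J)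
    (hH : ∀ (m n : ℕ) (j : Fin m ↪ Fin n), ∀ φ ∈ Φ n, H φ j ∈ Φ m)
    (hcount : (dom J).Countable) {c : X} (hc : c ∉ dom J) {n : ℕ} {b : Fin n ↪ X} {θ : Psi L δ n}
    {hθ : θ ∈ Φ n} (hb : (⟨n, b, θ, hθ⟩ : TypedTuple X Φ) ∈ J) {φ : Psi L δ (n + 1)}
    (hφ : φ ∈ Φ (n + 1)) (hφθ : H φ (incl n.le_succ) = θ) :
    ∃ K : Set (TypedTuple X Φ), Order.IsIdeal K ∧ J ⊆ K ∧ dom K ⊆ insert c (dom J) ∧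
      Realizes K b φ := by
  by_cases hr : Realizes J b φ
  · exact ⟨J, hJ, subset_rfl, Set.subset_insert _ _, hr⟩
  have hnc : ∀ {q}, q ∈ J → c ∉ q.support := fun hq h => hc (support_subset_dom hq h)
  let r₀ : TypedTuple X Φ := TypedTuple.snoc ⟨n, b, θ, hθ⟩ c (hnc hb) φ hφ
  -- Conditions: typings of `c` over members of `J` that extend the demand `r₀` that `c` realize `φ`
  -- over `b`.
  let C : Set (TypedTuple X Φ) := {r | r₀ ≤ r ∧ ∃ q ∈ J, ∃ (hcq : c ∉ q.support)
    (χ : Psi L δ (q.size + 1)) (hχ : χ ∈ Φ (q.size + 1)),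
      H χ (incl q.size.le_succ) = q.type ∧ r = q.snoc c hcq χ hχ}
  have hr₀C : r₀ ∈ C := ⟨le_rfl, _, hb, hnc hb, φ, hφ, hφθ, rfl⟩
  have hstep : ∀ d : dom J, IsCofinal {r : C | d.1 ∈ r.1.support} := by
    rintro ⟨d, hd⟩ ⟨_, hle, q, hq, hcq, θ', hθ', hθq, rfl⟩
    rcases exists_amalgam hA hJ hH hq hc hcq hθ' hθq hd with
      ⟨hdq, hmem⟩ | ⟨q', hq', hcq', χ, hχ, h1, h2, h3⟩
    -- Here `d` realizes `θ'` over `q`. Replacing `c` by `d` in `r₀ ≤ q⌢c` and projecting shows that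
    -- `d` realizes `φ` over `b` in `J`, against `hr`.
    · refine (hr ?_).elim
      obtain ⟨j, hj, hj'⟩ := hle
      have hlast : j (Fin.last n) = Fin.last q.size := by
        refine (q.snoc c hcq θ' hθ').tuple.injective ?_
        refine (DFunLike.congr_fun hj (Fin.last n)).symm.trans ?_
        exact (Fin.Embedding.snoc_last (ha := hnc hb)).trans
          (Fin.Embedding.snoc_last (ha := hcq)).symm
      have hinit : ∀ i : Fin n, ∃ i' : Fin q.size, j i.castSucc = i'.castSucc := by
        intro i
        refine (Fin.eq_castSucc_or_eq_last (j i.castSucc)).resolve_right fun h => ?_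
        exact (Fin.castSucc_lt_last i).ne (j.injective (h.trans hlast.symm))
      have hbi : ∀ i : Fin n, ∀ i' : Fin q.size, j i.castSucc = i'.castSucc →
          b i = q.tuple i' := by
        intro i i' hi
        have := DFunLike.congr_fun hj i.castSucc
        have h1 : b i = (q.snoc c hcq θ' hθ').tuple (j i.castSucc) :=
          (Fin.Embedding.snoc_castSucc (ha := hnc hb)).symm.trans this
        rw [h1, hi]
        exact Fin.Embedding.snoc_castSucc (ha := hcq)
      have hdb : d ∉ Set.range b := by
        rintro ⟨i, rfl⟩
        obtain ⟨i', hi'⟩ := hinit i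
        exact hdq ⟨i', (hbi i i' hi').symm⟩
      refine ⟨d, hdb, hφ, hJ.IsLowerSet (a := q.snoc d hdq θ' hθ') ⟨j, ?_, hj'⟩ hmem⟩
      refine embedding_ext_snoc (fun i => ?_) ?_
      · obtain ⟨i', hi'⟩ := hinit i
        refine (Fin.Embedding.snoc_castSucc (ha := hdb)).trans ?_
        change _ = Fin.Embedding.snoc q.tuple hdq (j i.castSucc)
        rw [hi', hbi i i' hi']
        exact (Fin.Embedding.snoc_castSucc (ha := hdq)).symm
      · refine (Fin.Embedding.snoc_last (ha := hdb)).trans ?_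
        change _ = Fin.Embedding.snoc q.tuple hdq (j (Fin.last n))
        rw [hlast]
        exact (Fin.Embedding.snoc_last (ha := hdq)).symm
    · refine ⟨⟨_, hle.trans h2, q', hq', hcq', χ, hχ, h1, rfl⟩, ?_, h2⟩
      change d ∈ (q'.snoc c hcq' χ hχ).support
      rw [TypedTuple.support_snoc]
      exact Set.mem_insert_of_mem _ h3
  have : Countable (dom J) := hcount
  let _ : Encodable (dom J) := Encodable.ofCountable _
  let D : dom J → Order.Cofinal C := fun d => ⟨_, hstep d⟩
  let G := Order.idealOfCofinals ⟨r₀, hr₀C⟩ D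
  have hG : Order.IsIdeal {p | ∃ r ∈ G, p ≤ (r : TypedTuple X Φ)} := isIdeal_lowerClosure_image G
  refine ⟨{p | ∃ r ∈ G, p ≤ (r : TypedTuple X Φ)}, hG, ?_, ?_, ?_⟩
  -- The generic ideal absorbs every point of `q`, hence contains a condition `q'⌢c` covering it. As
  -- `c` is new, `q'` already covers `q`, and inclusion of supports within `J` gives `q ≤ q'`.
  · intro q hq
    have hsub : q.support ⊆ dom {p | ∃ r ∈ G, p ≤ (r : TypedTuple X Φ)} := by
      intro d hd
      obtain ⟨r, hr, hrG⟩ := Order.cofinal_meets_idealOfCofinals ⟨r₀, hr₀C⟩ D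
        ⟨d, support_subset_dom hq hd⟩
      exact mem_dom.2 ⟨r, ⟨r, hrG, le_rfl⟩, hr⟩
    obtain ⟨p, ⟨r, hrG, hpr⟩, hp⟩ := exists_support_superset hG.Nonempty hG.Directed
      (Set.finite_range q.tuple) hsub
    obtain ⟨r, hrle, q', hq', hcq', χ, hχ, hχ', rfl⟩ := r
    refine ⟨_, hrG, le_trans ?_ (le_snoc q' c hcq' χ hχ hχ')⟩
    refine le_of_support_subset hJ.Directed hq hq' fun e he => ?_
    have := TypedTuple.support_mono hpr (hp he)
    change e ∈ (q'.snoc c hcq' χ hχ).support at this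
    rw [TypedTuple.support_snoc] at this
    rcases this with rfl | h
    · exact (hnc hq he).elim
    · exact h
  · intro e he
    obtain ⟨p, ⟨⟨r, hrle, q', hq', hcq', χ, hχ, hχ', rfl⟩, hrG, hpr⟩, hp⟩ := mem_dom.1 he
    have := TypedTuple.support_mono hpr hp
    change e ∈ (q'.snoc c hcq' χ hχ).support at this
    rw [TypedTuple.support_snoc] at this
    exact Set.insert_subset_insert (support_subset_dom hq') this
  · exact ⟨c, hnc hb, hφ, ⟨r₀, hr₀C⟩, Order.mem_idealOfCofinals _ _, le_rfl⟩

end Extension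

/-! ## Realizing all formulas in `ω₁` steps -/

section Saturation

variable {X : Type x} {δ : Ordinal.{w}} {Φ : ∀ n : ℕ, Set (Psi L δ n)}

/-- Every formula over a member of `J` is realized in `J`. -/
def IsFull (J : Set (TypedTuple X Φ)) : Prop :=
  ∀ (n : ℕ) (b : Fin n ↪ X) (θ : Psi L δ n) (hθ : θ ∈ Φ n),
    (⟨n, b, θ, hθ⟩ : TypedTuple X Φ) ∈ J →
      ∀ φ ∈ Φ (n + 1), H φ (incl n.le_succ) = θ → Realizes J b φ

/-- A tuple and a formula that might be realized by a one-point extension of the tuple. -/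
abbrev Task (X : Type x) (Φ : ∀ n : ℕ, Set (Psi L δ n)) := Σ n : ℕ, (Fin n ↪ X) × Φ (n + 1)

/-- The factor `X` gives each task as many numbers as `X` has points, so that some number comes
after all entries of its tuple. -/
theorem exists_task_embedding [Infinite X] (e : (Σ n : ℕ, Φ n) ↪ X) :
    Nonempty (Task X Φ × X ↪ X) := by
  have h : #((List X × X) × X) ≤ #X := by simp
  obtain ⟨g⟩ := h
  let f : Task X Φ × X → (List X × X) × X :=
    fun p => ((List.ofFn p.1.2.1, e ⟨p.1.1 + 1, p.1.2.2⟩), p.2)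
  refine ⟨⟨fun p => g (f p), fun p q h => ?_⟩⟩
  obtain ⟨⟨n, b, φ⟩, z⟩ := p
  obtain ⟨⟨m, c, ψ⟩, z'⟩ := q
  have h := g.injective h
  simp only [f, Prod.mk.injEq, EmbeddingLike.apply_eq_iff_eq] at h
  obtain ⟨⟨h1, h2⟩, rfl⟩ := h
  obtain rfl : n = m := by simpa using congrArg Sigma.fst h2
  obtain rfl : φ = ψ := by simpa using h2
  obtain rfl : b = c := DFunLike.coe_injective (List.ofFn_injective h1)
  rfl

/-- The tasks with number `ξ` that speak about elements below `ξ` only are fulfilled in `J`. -/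
def Handles [LT X] (g : Task X Φ × X ↪ X) (J : Set (TypedTuple X Φ)) (ξ : X) : Prop :=
  ∀ (n : ℕ) (b : Fin n ↪ X) (φ : Φ (n + 1)) (z : X), g (⟨n, b, φ⟩, z) = ξ → (∀ i, b i < ξ) →
    (∃ hθ, (⟨n, b, H φ.1 (incl n.le_succ), hθ⟩ : TypedTuple X Φ) ∈ J) → Realizes J b φ.1

/-- As `g` is injective, `ξ` numbers at most one task, so the single point `ξ` suffices. Without an
applicable task, `J` is kept and `ξ` stays outside the domain. -/
theorem exists_handling_extension [LT X] (g : Task X Φ × X ↪ X) (hA : Amalgamates Φ)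
    {J : Set (TypedTuple X Φ)} (hJ : Order.IsIdeal J)
    (hH : ∀ (m n : ℕ) (j : Fin m ↪ Fin n), ∀ φ ∈ Φ n, H φ j ∈ Φ m)
    (hcount : (dom J).Countable) {ξ : X} (hξ : ξ ∉ dom J) :
    ∃ K : Set (TypedTuple X Φ), Order.IsIdeal K ∧ J ⊆ K ∧ dom K ⊆ insert ξ (dom J) ∧
      Handles g K ξ := by
  by_cases h : ∃ (n : ℕ) (b : Fin n ↪ X) (φ : Φ (n + 1)) (z : X), g (⟨n, b, φ⟩, z) = ξ ∧
      (∀ i, b i < ξ) ∧ ∃ hθ, (⟨n, b, H φ.1 (incl n.le_succ), hθ⟩ : TypedTuple X Φ) ∈ J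
  · obtain ⟨n, b, φ, z, hz, hb, hθ, hmem⟩ := h
    obtain ⟨K, hK, hJK, hdom, hr⟩ :=
      exists_realizing_extension hA hJ hH hcount hξ hmem φ.2 rfl
    refine ⟨K, hK, hJK, hdom, fun n' b' φ' z' hz' _ _ => ?_⟩
    have := g.injective (hz.trans hz'.symm)
    simp only [Prod.mk.injEq] at this
    obtain ⟨h1, -⟩ := this
    obtain rfl : n = n' := congrArg Sigma.fst h1
    simp only [Sigma.mk.injEq, heq_eq_eq, true_and, Prod.mk.injEq] at h1
    obtain ⟨rfl, rfl⟩ := h1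
    exact hr
  · refine ⟨J, hJ, subset_rfl, Set.subset_insert _ _, fun n b φ z hz hb hJ' => ?_⟩
    exact (h ⟨n, b, φ, z, hz, hb, hJ'⟩).elim

theorem isIdeal_sUnion {P : Type*} [LE P] {c : Set (Set P)} (hne : c.Nonempty)
    (hc : IsChain (· ⊆ ·) c) (h : ∀ J ∈ c, Order.IsIdeal J) : Order.IsIdeal (⋃₀ c) where
  IsLowerSet := isLowerSet_sUnion fun J hJ => (h J hJ).IsLowerSet
  Nonempty := by
    obtain ⟨J, hJ⟩ := hne
    exact (h J hJ).Nonempty.mono (Set.subset_sUnion_of_mem hJ)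
  Directed := by
    rintro p ⟨J, hJ, hp⟩ q ⟨K, hK, hq⟩
    obtain ⟨M, hM, h1, h2⟩ := hc.directedOn J hJ K hK
    obtain ⟨r, hr, h3⟩ := (h M hM).Directed p (h1 hp) q (h2 hq)
    exact ⟨r, ⟨M, hM, hr⟩, h3⟩

/-- Zorn's lemma replaces the recursion of length `ω₁`. The initial segment `I` of treated stages is
carried along with `J`, because a stage may add no point and so `dom J` does not determine it. -/
theorem exists_isFull [LinearOrder X] [WellFoundedLT X] [Uncountable X]
    (hX : ∀ ξ : X, (Set.Iio ξ).Countable) (e : (Σ n : ℕ, Φ n) ↪ X) (hA : Amalgamates Φ)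
    (hH : ∀ (m n : ℕ) (j : Fin m ↪ Fin n), ∀ φ ∈ Φ n, H φ j ∈ Φ m)
    {θ₀ : Psi L δ 0} (hθ₀ : θ₀ ∈ Φ 0) :
    ∃ J : Set (TypedTuple X Φ), Order.IsIdeal J ∧ IsFull J := by
  obtain ⟨g⟩ := exists_task_embedding e
  let s : Set (Set X × Set (TypedTuple X Φ)) :=
    {p | IsLowerSet p.1 ∧ Order.IsIdeal p.2 ∧ dom p.2 ⊆ p.1 ∧ ∀ ξ ∈ p.1, Handles g p.2 ξ}
  let t₀ : TypedTuple X Φ := ⟨0, Function.Embedding.ofIsEmpty, θ₀, hθ₀⟩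
  have hbase : ((∅ : Set X), Set.Iic t₀) ∈ s := by
    refine ⟨isLowerSet_empty, ⟨isLowerSet_Iic _, ⟨t₀, Set.mem_Iic.2 le_rfl⟩,
      fun p hp q hq => ⟨t₀, Set.mem_Iic.2 le_rfl, hp, hq⟩⟩, ?_, fun ξ hξ => hξ.elim⟩
    intro c hc
    obtain ⟨p, hp, hcp⟩ := mem_dom.1 hc
    obtain ⟨i, -⟩ := TypedTuple.support_mono hp hcp
    exact i.elim0
  obtain ⟨⟨I, J⟩, -, ⟨hI, hJ, hdom, hh⟩, hmax⟩ := zorn_le_nonempty₀ s (fun c hcs hc y hy => by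
    have hc2 : IsChain (· ⊆ ·) (Prod.snd '' c) :=
      hc.image_of_map_rel _ _ _ fun _ _ h => h.2
    refine ⟨(⋃₀ (Prod.fst '' c), ⋃₀ (Prod.snd '' c)), ⟨?_, ?_, ?_, ?_⟩, fun z hz => ⟨?_, ?_⟩⟩
    · refine isLowerSet_sUnion ?_
      rintro _ ⟨p, hp, rfl⟩
      exact (hcs hp).1
    · refine isIdeal_sUnion ⟨_, y, hy, rfl⟩ hc2 ?_
      rintro _ ⟨p, hp, rfl⟩
      exact (hcs hp).2.1
    · intro d hd
      obtain ⟨q, ⟨_, ⟨p, hp, rfl⟩, hq⟩, hdq⟩ := mem_dom.1 hd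
      exact ⟨_, ⟨p, hp, rfl⟩, (hcs hp).2.2.1 (mem_dom.2 ⟨q, hq, hdq⟩)⟩
    -- The pair that has treated `ξ` and the pair that types the tuple may differ; the larger of the
    -- two does both.
    · rintro ξ ⟨_, ⟨p, hp, rfl⟩, hξ⟩ n b φ z hz hb ⟨hθ, _, ⟨p', hp', rfl⟩, hmem⟩
      obtain ⟨r, hr, h1, h2⟩ := hc.directedOn p hp p' hp'
      exact ((hcs hr).2.2.2 ξ (h1.1 hξ) n b φ z hz hb ⟨hθ, h2.2 hmem⟩).mono
        (Set.subset_sUnion_of_mem (Set.mem_image_of_mem _ hr))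
    · exact Set.subset_sUnion_of_mem ⟨z, hz, rfl⟩
    · exact Set.subset_sUnion_of_mem ⟨z, hz, rfl⟩) _ hbase
  have hIuniv : I = Set.univ := by
    by_contra hne
    obtain ⟨ξ, hξ, hmin⟩ := WellFounded.has_min (wellFounded_lt (α := X)) Iᶜ
      (Set.nonempty_compl.2 hne)
    have hIlt : I ⊆ Set.Iio ξ := fun η hη => lt_of_not_ge fun hle => hξ (hI hle hη)
    have hltI : Set.Iio ξ ⊆ I := fun η hη => by_contra fun hn => hmin η hn hη
    obtain ⟨K, hK, hJK, hdK, hhK⟩ := exists_handling_extension g hA hJ hH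
      ((hX ξ).mono (hdom.trans hIlt)) fun h => hξ (hdom h)
    have hmem : (insert ξ I, K) ∈ s := by
      refine ⟨?_, hK, hdK.trans (Set.insert_subset_insert hdom), ?_⟩
      · rintro η ζ hle (rfl | hη)
        · rcases hle.lt_or_eq with h | rfl
          · exact Or.inr (hltI h)
          · exact Or.inl rfl
        · exact Or.inr (hI hle hη)
      · rintro η (rfl | hη)
        · exact hhK
        -- Adding `ξ` creates no task for an earlier `η`: the entries of `b` lie below `η < ξ`,
        -- hence in `dom J`, and uniqueness of types puts the typed tuple into `J`.
        · rintro n b φ z hz hb ⟨hθ, hmem⟩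
          refine (hh η hη n b φ z hz hb ⟨hθ, ?_⟩).mono hJK
          have hsub : Set.range b ⊆ dom J := by
            rintro _ ⟨i, rfl⟩
            refine (hdK (support_subset_dom hmem ⟨i, rfl⟩)).resolve_left fun h => ?_
            exact lt_asymm (hb i) (by rw [h]; exact hIlt hη)
          obtain ⟨θ, hθ', hmem'⟩ := exists_type_of_subset_dom hJ hH b hsub
          obtain rfl := type_unique hK.Directed hmem (hJK hmem')
          exact hmem'
    exact hξ ((hmax hmem ⟨Set.subset_insert _ _, hJK⟩).1 (Set.mem_insert _ _))
  refine ⟨J, hJ, fun n b θ hθ hmem φ hφ hφθ => ?_⟩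
  -- The task has uncountably many numbers, and only countably many points lie below or at an entry
  -- of `b`.
  obtain ⟨z, hz⟩ : ∃ z, g (⟨n, b, φ, hφ⟩, z) ∉ ⋃ i, Set.Iic (b i) := by
    by_contra! hall
    have hc : (⋃ i, Set.Iic (b i)).Countable := Set.countable_iUnion fun i => by
      rw [← Set.Iio_insert]
      exact (hX _).insert _
    have : Function.Injective fun z : X =>
        (⟨g (⟨n, b, φ, hφ⟩, z), hall z⟩ : ⋃ i, Set.Iic (b i)) := fun z z' h => by
      have := g.injective (congrArg Subtype.val h)
      exact (Prod.mk.inj this).2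
    have : Countable (⋃ i, Set.Iic (b i) : Set X) := hc
    exact not_countable (α := X) (Function.Injective.countable ‹Function.Injective _›)
  subst hφθ
  exact hh _ (by rw [hIuniv]; trivial) n b ⟨φ, hφ⟩ z rfl
    (fun i => lt_of_not_ge fun h => hz (Set.mem_iUnion.2 ⟨i, h⟩)) ⟨hθ, hmem⟩

end Saturation

/-! ## The structure defined by a full ideal -/

section Model

variable {X : Type x} {δ : Ordinal.{w}} {Φ : ∀ n : ℕ, Set (Psi L δ n)}

/-- The structure on the domain of `J` in which a relation holds if some member of `J`
says so. -/
abbrev modelOf [L.IsRelational] (J : Set (TypedTuple X Φ)) : L.Structure (dom J) where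
  funMap f := isEmptyElim f
  RelMap {k} R a := ∃ p ∈ J, ∃ f : Fin k → Fin p.size,
    (∀ i, (a i : X) = p.tuple (f i)) ∧ (⟨k, R, f⟩ : AtomF L p.size) ∈ p.type.atoms

variable {J : Set (TypedTuple X Φ)}

theorem atoms_iff_of_directedOn (hJ : DirectedOn (· ≤ ·) J) {p q : TypedTuple X Φ} (hp : p ∈ J)
    (hq : q ∈ J) {k : ℕ} (R : L.Relations k) {f : Fin k → Fin p.size} {g : Fin k → Fin q.size}
    (h : ∀ i, p.tuple (f i) = q.tuple (g i)) :
    (⟨k, R, f⟩ : AtomF L p.size) ∈ p.type.atoms ↔ (⟨k, R, g⟩ : AtomF L q.size) ∈ q.type.atoms := by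
  obtain ⟨s, -, ⟨j, hj, hj'⟩, l, hl, hl'⟩ := hJ p hp q hq
  rw [hj', hl', atoms_H, atoms_H]
  have : j ∘ f = l ∘ g := by
    funext i
    refine s.tuple.injective ?_
    have := h i
    rw [hj, hl] at this
    exact this
  change (⟨k, R, j ∘ f⟩ : AtomF L s.size) ∈ s.type.atoms ↔
    (⟨k, R, l ∘ g⟩ : AtomF L s.size) ∈ s.type.atoms
  rw [this]

/-- Induction on `α`, comparing the sets `E` at each `β < α`. The type of `a⌢c` projects to `θ`, so
condition 5 puts its `β`-part into `E`. Conversely, condition 6 lifts a member of `E` to a formula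
of `Φ δ` over `θ`, which fullness realizes. -/
theorem scottFormula_modelOf [L.IsRelational] {Φ : ∀ (α : Ordinal.{w}) (n : ℕ), Set (Psi L α n)}
    (hΦ : IsScottProc (δ + 1) Φ) {J : Set (TypedTuple X (Φ δ))} (hJ : Order.IsIdeal J)
    (hfull : IsFull J) {α : Ordinal.{w}} (hα : α ≤ δ) {n : ℕ} (a : Fin n ↪ dom J) {θ : Psi L δ n}
    {hθ : θ ∈ Φ δ n}
    (ha : (⟨n, a.trans (Function.Embedding.subtype _), θ, hθ⟩ : TypedTuple X (Φ δ)) ∈ J) :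
    @scottFormula L (dom J) (modelOf J) α n a = V hα θ := by
  let _ := modelOf J
  have hδ : δ < δ + 1 := lt_add_one δ
  induction α using WellFoundedLT.induction generalizing n with
  | ind α ih =>
    rw [scottFormula]
    refine eq_of ?_ fun β hβ => ?_
    · rw [atoms_mk, atoms_V]
      ext ⟨k, R, f⟩
      constructor
      · rintro ⟨q, hq, g, hg, hR⟩
        exact (atoms_iff_of_directedOn hJ.Directed ha hq R hg).2 hR
      · intro hR
        exact ⟨_, ha, f, fun i => rfl, hR⟩
    · have hβδ : β < δ := hβ.trans_le hα
      have hβ1 : β + 1 ≤ δ := Order.add_one_le_of_lt hβδ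
      have hV : V hβ1 θ ∈ Φ (β + 1) n := by
        rcases hβ1.lt_or_eq with h | h
        · rw [hΦ.eq_image_V _ _ h hδ]
          exact ⟨θ, hθ, rfl⟩
        · subst h
          rwa [V_self]
      rw [ext_mk, ext_V, ← E_V hβ1]
      ext χ
      constructor
      · rintro ⟨c, hc, rfl⟩
        obtain ⟨ψ, hψ, hψJ⟩ := exists_type_of_subset_dom hJ (fun m n j φ => hΦ.H_mem' hδ j)
          ((Fin.Embedding.snoc a hc).trans (Function.Embedding.subtype _))
          (by rintro _ ⟨i, rfl⟩; exact Subtype.prop _)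
        rw [ih β hβ hβδ.le _ hψJ]
        have hc' : c.1 ∉ Set.range (a.trans (Function.Embedding.subtype _)) := by
          rintro ⟨i, hi⟩
          exact hc ⟨i, Subtype.ext hi⟩
        have heq : (Fin.Embedding.snoc a hc).trans (Function.Embedding.subtype _) =
            Fin.Embedding.snoc (a.trans (Function.Embedding.subtype _)) hc' :=
          embedding_ext_snoc (fun i => by simp) (by simp)
        have hψθ : H ψ (incl n.le_succ) = θ := by
          let p : TypedTuple X (Φ δ) := ⟨n, a.trans (Function.Embedding.subtype _), θ, hθ⟩
          have hmem : p.snoc c.1 hc' ψ hψ ∈ J := by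
            rw [heq] at hψJ
            exact hψJ
          exact H_incl_eq_of_le_snoc (q := p) (le_of_support_subset hJ.Directed ha hmem
            ((Set.subset_insert _ _).trans (p.support_snoc c.1 hc' ψ hψ).ge))
        rw [hΦ.E_eq β (Order.lt_add_one_iff.2 hβ1) n _ hV]
        refine ⟨V hβ1 ψ, ⟨?_, ?_⟩, V_V _ _ _⟩
        · rcases hβ1.lt_or_eq with h | h
          · rw [hΦ.eq_image_V _ _ h hδ]
            exact ⟨ψ, hψ, rfl⟩
          · subst h
            rwa [V_self]
        · rw [← V_H, hψθ]
      · intro hχ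
        obtain ⟨ψ, ⟨hψ, hψθ⟩, rfl⟩ := hΦ.E_V_subset β δ hβδ hδ n θ hθ hχ
        obtain ⟨d, hd, hψ', hmem⟩ := hfull n _ θ hθ ha ψ hψ hψθ
        have hdJ : d ∈ dom J := mem_dom.2 ⟨_, hmem, Fin.last n, Fin.Embedding.snoc_last (ha := hd)⟩
        have hd' : (⟨d, hdJ⟩ : dom J) ∉ Set.range a := by
          rintro ⟨i, hi⟩
          exact hd ⟨i, congrArg Subtype.val hi⟩
        have heq : (Fin.Embedding.snoc a hd').trans (Function.Embedding.subtype _) =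
            Fin.Embedding.snoc (a.trans (Function.Embedding.subtype _)) hd :=
          embedding_ext_snoc (fun i => by simp) (by simp)
        refine ⟨⟨d, hdJ⟩, hd', ?_⟩
        rw [← heq] at hmem
        exact (ih β hβ hβδ.le _ hmem).symm

/-- Both are projections of one formula along the only injection of the empty set of variables. -/
theorem eq_of_mem_zero {ℓ α : Ordinal.{w}} {Φ : ∀ (α : Ordinal.{w}) (n : ℕ), Set (Psi L α n)}
    (hΦ : IsScottProc ℓ Φ) (hα : α < ℓ) {φ ψ : Psi L α 0} (hφ : φ ∈ Φ α 0) (hψ : ψ ∈ Φ α 0) :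
    φ = ψ := by
  obtain ⟨θ, -, j, h1, h2⟩ := hΦ.combine α hα 0 0 φ hφ ψ hψ
  rw [h1, h2]
  congr 1
  ext i
  exact i.elim0

/-- Induction on the number of variables: the sentence is unique, and fullness supplies each further
point. -/
theorem exists_tuple_of_mem {Φ : ∀ (α : Ordinal.{w}) (n : ℕ), Set (Psi L α n)}
    (hΦ : IsScottProc (δ + 1) Φ) {J : Set (TypedTuple X (Φ δ))} (hJ : Order.IsIdeal J)
    (hfull : IsFull J) {n : ℕ} (θ : Psi L δ n) (hθ : θ ∈ Φ δ n) :
    ∃ b : Fin n ↪ X, (⟨n, b, θ, hθ⟩ : TypedTuple X (Φ δ)) ∈ J := by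
  have hδ : δ < δ + 1 := lt_add_one δ
  induction n with
  | zero =>
    obtain ⟨θ', hθ', h⟩ := exists_type_of_subset_dom hJ (fun m n j φ => hΦ.H_mem' hδ j)
      (Function.Embedding.ofIsEmpty : Fin 0 ↪ X) (by rintro _ ⟨i, -⟩; exact i.elim0)
    obtain rfl := eq_of_mem_zero hΦ hδ hθ hθ'
    exact ⟨_, h⟩
  | succ n ih =>
    obtain ⟨b, hb⟩ := ih (H θ (incl n.le_succ)) (hΦ.H_mem' hδ _ hθ)
    obtain ⟨d, hd, hθ', h⟩ := hfull n b _ _ hb θ hθ rfl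
    exact ⟨_, h⟩

theorem isModelOf_modelOf [L.IsRelational] {Φ : ∀ (α : Ordinal.{w}) (n : ℕ), Set (Psi L α n)}
    (hΦ : IsScottProc (δ + 1) Φ) {J : Set (TypedTuple X (Φ δ))} (hJ : Order.IsIdeal J)
    (hfull : IsFull J) : @IsModelOf L (dom J) (modelOf J) (δ + 1) Φ := by
  have hδ : δ < δ + 1 := lt_add_one δ
  intro α hα n
  have hαδ : α ≤ δ := Order.lt_add_one_iff.1 hα
  have himage : Φ α n = V hαδ '' Φ δ n := by
    rcases hαδ.lt_or_eq with h | rfl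
    · exact hΦ.eq_image_V α δ h hδ n
    · simp [V_self]
  rw [himage]
  ext φ
  constructor
  · rintro ⟨θ, hθ, rfl⟩
    obtain ⟨b, hb⟩ := exists_tuple_of_mem hΦ hJ hfull θ hθ
    exact ⟨⟨fun i => ⟨b i, mem_dom.2 ⟨_, hb, i, rfl⟩⟩, fun i j h =>
      b.injective (congrArg Subtype.val h)⟩, scottFormula_modelOf hΦ hJ hfull hαδ _ hb⟩
  · rintro ⟨a, rfl⟩
    obtain ⟨θ, hθ, hmem⟩ := exists_type_of_subset_dom hJ (fun m n j φ => hΦ.H_mem' hδ j)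
      (a.trans (Function.Embedding.subtype _)) (by rintro _ ⟨i, rfl⟩; exact Subtype.prop _)
    exact ⟨θ, hθ, (scottFormula_modelOf hΦ hJ hfull hαδ a hmem).symm⟩

end Model

end ScottAnalysis

/-! ### The model on a subset of `ω₁` -/

theorem mainTheorem4 (L : FirstOrder.Language.{u, v}) [L.IsRelational] (δ : Ordinal.{w})
    (Φ : ∀ (α : Ordinal.{w}) (n : ℕ), Set (ScottAnalysis.Psi L α n))
    (hΦ : ScottAnalysis.IsScottProc (δ + 1) Φ)
    (hne : ∃ n, (Φ δ n).Nonempty)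
    (hamalg : ScottAnalysis.Amalgamates (Φ δ))
    (hcard : #(Σ n : ℕ, Φ δ n) ≤ ℵ₁) :
    ∃ (M : Type) (_ : L.Structure M), ScottAnalysis.IsModelOf M (δ + 1) Φ := by
  have hδ : δ < δ + 1 := lt_add_one δ
  obtain ⟨n, φ, hφ⟩ := hne
  let X : Type := (ord ℵ₁).ToType
  have hX : #X = ℵ₁ := by simp [X]
  have : Uncountable X := by
    rw [← aleph0_lt_mk_iff, hX]
    exact aleph0_lt_aleph_one
  have hIio : ∀ ξ : X, (Set.Iio ξ).Countable := fun ξ => by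
    rw [← le_aleph0_iff_set_countable, ← Order.lt_succ_iff, succ_aleph0]
    exact (mk_Iio_lt ξ (by simp [X])).trans_eq hX
  obtain ⟨e⟩ : Nonempty ((Σ n : ℕ, Φ δ n) ↪ X) := by
    rw [← lift_mk_le', hX]
    simpa using hcard
  -- The construction starts from the sentence obtained by projecting `φ` to no variables.
  obtain ⟨J, hJ, hfull⟩ := ScottAnalysis.exists_isFull hIio e hamalg
    (fun m n j φ => hΦ.H_mem' hδ j) (hΦ.H_mem' hδ Function.Embedding.ofIsEmpty hφ)
  exact ⟨ScottAnalysis.dom J, ScottAnalysis.modelOf J, ScottAnalysis.isModelOf_modelOf hΦ hJ hfull⟩
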